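/- Let $p$ be a prime, $C$ a field of characteristic $p$, and $D$ a finite-dimensional central division algebra over $C$ ($D=C$ is allowed). Let $\delta$ be a derivation of $D$; it maps $C$ into $C$. Put $F=\{c\in C : \delta(c)=0\}$, and assume that $\delta|_C$ is algebraic over $F$ with minimum polynomial $$g(t)=t^{p^e}+a_1t^{p^{e-1}}+\dots+a_et\in F[t].$$ Let $D[t;\delta]$ be the differential polynomial ring (left coefficients, $ta=at+\delta(a)$ for $a\in D$), let $d\in D$ and $f(t)=g(t)-d\in D[t;\delta]$. Let $S_f$ be the nonassociative $F$-algebra of all $h\in D[t;\delta]$ with $\deg h<\deg f$, with multiplication $h\circ k=$ the remainder $r$ of $hk=qf+r$, $\deg r<\deg f$. Let ${\rm Aut}_F(S_f)$ be its group of $F$-algebra automorphisms. For $b\in C$ let $G_{id,-b}\big(\sum_i c_it^i\big)=\sum_i c_i(t-b)^i$ ($c_i\in D$). For $b\in C$ and $j\ge 0$ let $V_{p^j}(b)=\sum_{i=0}^{j}\big(\delta^{p^i-1}(b)\big)^{p^{j-i}}\in C$ (so $V_1(b)=b$ and $V_p(b)=b^p+\delta^{p-1}(b)$), and let $$V(b)=V_{p^e}(b)+a_1V_{p^{e-1}}(b)+\dots+a_eb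 .$$ Then: 1. $(t-b)^{p^j}=t^{p^j}-V_{p^j}(b)$ in $D[t;\delta]$ for all $b\in C$ and $j\ge 0$. 2. $V$ is an additive map from $C$ to $F$; in particular $V(b)\in F$ for all $b\in C$. 3. $\ker(V)=\{b\in C : V(b)=0\}=\{\delta(c)/c : c\in C,\ c\neq 0\}$. 4. For every $b\in\ker(V)$ the map $G_{id,-b}$ restricts to an $F$-algebra automorphism of $S_f$. These automorphisms form a subgroup $\{G_{id,-b} : b\in C,\ V(b)=0\}$ of ${\rm Aut}_F(S_f)$, and $b\mapsto G_{id,-b}$ is a group isomorphism from the additive group $\ker(V)$ onto this subgroup. -/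

import Mathlib

/-- A derivation of a (not necessarily commutative) ring: an additive map with
`δ (a * b) = a * δ b + δ a * b`. -/
structure RingDerivation (D : Type*) [Ring D] extends D →+ D where
  leibniz' : ∀ a b : D, toFun (a * b) = a * toFun b + toFun a * b

namespace RingDerivation

variable {D : Type*} [Ring D] (δ : RingDerivation D)

instance : FunLike (RingDerivation D) D D where
  coe δ := δ.toFun
  coe_injective := by
    rintro ⟨⟨⟨f, _⟩, _⟩, _⟩ ⟨⟨⟨g, _⟩, _⟩, _⟩ h
    cases h
    rfl

instance : AddMonoidHomClass (RingDerivation D) D D where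
  map_add δ := δ.map_add'
  map_zero δ := δ.map_zero'

theorem leibniz (a b : D) : δ (a * b) = a * δ b + δ a * b := δ.leibniz' a b

theorem map_one_eq_zero : δ 1 = 0 := by
  have h := δ.leibniz 1 1
  simpa using h

end RingDerivation

open Polynomial in
/-- The differential polynomial ring `D[t;δ]`. Its elements are the polynomials `∑ aᵢ tⁱ` with
coefficients on the left, so it is `D[X]` as a left `D`-module; its multiplication is the one
with `t * a = a * t + δ a`. -/
def DiffPoly {D : Type*} [Ring D] (_δ : RingDerivation D) : Type _ := D[X]

namespace DiffPoly

open Polynomial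

section Multiplication

variable {D : Type*} [Ring D] (δ : RingDerivation D)

noncomputable instance : AddCommGroup (DiffPoly δ) := inferInstanceAs (AddCommGroup D[X])

noncomputable instance : Module D (DiffPoly δ) := inferInstanceAs (Module D D[X])

/-- The map `∑ aᵢ tⁱ ↦ ∑ δ(aᵢ) tⁱ`. -/
noncomputable def coeffDer : D[X] →+ D[X] where
  toFun h := h.sum fun i a => monomial i (δ a)
  map_zero' := by simp
  map_add' x y := by
    refine Polynomial.sum_add_index x y _ (fun i => by simp) (fun i a b => by simp)

/-- Left multiplication by `t`: `t * ∑ aᵢ tⁱ = ∑ aᵢ tⁱ⁺¹ + ∑ δ(aᵢ) tⁱ`. -/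
noncomputable def tMul : D[X] →+ D[X] where
  toFun h := h * X + coeffDer δ h
  map_zero' := by simp
  map_add' x y := by rw [add_mul, map_add]; abel

/-- The product in `D[t;δ]`: `(∑ aᵢ tⁱ) * h = ∑ aᵢ Tⁱ(h)`, where `T` is left multiplication
by `t`. -/
noncomputable def mulFun (f h : D[X]) : D[X] :=
  f.sum fun i a => Polynomial.C a * (tMul δ)^[i] h

theorem coeffDer_monomial (i : ℕ) (a : D) :
    coeffDer δ (monomial i a) = monomial i (δ a) := by
  simp [coeffDer, Polynomial.sum_monomial_index]

theorem tMul_apply (h : D[X]) : tMul δ h = h * X + coeffDer δ h := rfl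

theorem tMul_monomial (i : ℕ) (a : D) :
    tMul δ (monomial i a) = monomial (i + 1) a + monomial i (δ a) := by
  rw [tMul_apply, coeffDer_monomial, monomial_mul_X]

theorem mulFun_add_left (f g h : D[X]) : mulFun δ (f + g) h = mulFun δ f h + mulFun δ g h :=
  Polynomial.sum_add_index f g _ (fun i => by simp) (fun i a b => by rw [C_add, add_mul])

theorem mulFun_zero_left (h : D[X]) : mulFun δ 0 h = 0 := by simp [mulFun]

theorem mulFun_monomial (i : ℕ) (a : D) (h : D[X]) :
    mulFun δ (monomial i a) h = Polynomial.C a * (tMul δ)^[i] h := by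
  simp [mulFun, Polynomial.sum_monomial_index]

theorem mulFun_add_right (f g h : D[X]) : mulFun δ f (g + h) = mulFun δ f g + mulFun δ f h := by
  induction f using Polynomial.induction_on' with
  | add p q hp hq => rw [mulFun_add_left, mulFun_add_left, mulFun_add_left, hp, hq]; abel
  | monomial n b => simp only [mulFun_monomial, iterate_map_add, mul_add]

theorem mulFun_zero_right (f : D[X]) : mulFun δ f 0 = 0 := by
  simp [mulFun, iterate_map_zero, Polynomial.sum]

theorem tMul_C_mul (a : D) (h : D[X]) :
    tMul δ (Polynomial.C a * h) = Polynomial.C a * tMul δ h + Polynomial.C (δ a) * h := by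
  induction h using Polynomial.induction_on' with
  | add p q hp hq => rw [mul_add, map_add, hp, hq, map_add]; noncomm_ring
  | monomial n b =>
    rw [C_mul_monomial, tMul_monomial, tMul_monomial, mul_add, C_mul_monomial, C_mul_monomial,
      C_mul_monomial, δ.leibniz, map_add]
    abel

theorem mulFun_C_mul (a : D) (f h : D[X]) :
    mulFun δ (Polynomial.C a * f) h = Polynomial.C a * mulFun δ f h := by
  induction f using Polynomial.induction_on' with
  | add p q hp hq => rw [mul_add, mulFun_add_left, hp, hq, mulFun_add_left, mul_add]
  | monomial n b => rw [C_mul_monomial, mulFun_monomial, mulFun_monomial, C_mul, mul_assoc]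

theorem mulFun_tMul (f h : D[X]) : mulFun δ (tMul δ f) h = tMul δ (mulFun δ f h) := by
  induction f using Polynomial.induction_on' with
  | add p q hp hq => rw [map_add, mulFun_add_left, hp, hq, mulFun_add_left, map_add]
  | monomial n b =>
    rw [tMul_monomial, mulFun_add_left, mulFun_monomial, mulFun_monomial, mulFun_monomial,
      tMul_C_mul, Function.iterate_succ_apply']

theorem mulFun_assoc (f g h : D[X]) :
    mulFun δ (mulFun δ f g) h = mulFun δ f (mulFun δ g h) := by
  induction f using Polynomial.induction_on' with
  | add p q hp hq =>
    rw [mulFun_add_left, mulFun_add_left, mulFun_add_left, hp, hq]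
  | monomial n b =>
    rw [mulFun_monomial, mulFun_monomial, mulFun_C_mul]
    congr 1
    induction n with
    | zero => rfl
    | succ n ih => rw [Function.iterate_succ_apply', Function.iterate_succ_apply', mulFun_tMul, ih]

theorem mulFun_one_left (h : D[X]) : mulFun δ 1 h = h := by
  rw [← monomial_zero_one, mulFun_monomial]
  simp

theorem mulFun_one_right (f : D[X]) : mulFun δ f 1 = f := by
  induction f using Polynomial.induction_on' with
  | add p q hp hq => rw [mulFun_add_left, hp, hq]
  | monomial n b =>
    have key : ∀ k : ℕ, (tMul δ)^[k] (1 : D[X]) = monomial k 1 := by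
      intro k
      induction k with
      | zero => simp
      | succ k ih =>
        rw [Function.iterate_succ_apply', ih, tMul_monomial, δ.map_one_eq_zero]
        simp
    rw [mulFun_monomial, key n, C_mul_monomial, mul_one]

noncomputable instance : Ring (DiffPoly δ) where
  __ := (inferInstance : AddCommGroup (DiffPoly δ))
  mul := mulFun δ
  one := (1 : D[X])
  left_distrib := mulFun_add_right δ
  right_distrib := mulFun_add_left δ
  zero_mul := mulFun_zero_left δ
  mul_zero := mulFun_zero_right δ
  mul_assoc := mulFun_assoc δ
  one_mul := mulFun_one_left δ
  mul_one := mulFun_one_right δ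

/-- The differential polynomial with the given left coefficients. -/
def ofPoly (f : D[X]) : DiffPoly δ := f

variable {δ} in
/-- The polynomial of left coefficients of a differential polynomial. -/
def toPoly (f : DiffPoly δ) : D[X] := f

/-- The indeterminate `t`. -/
noncomputable def t : DiffPoly δ := ofPoly δ X

/-- The constant polynomial `a`. -/
noncomputable def const (a : D) : DiffPoly δ := ofPoly δ (Polynomial.C a)

theorem const_mul (a : D) (f : DiffPoly δ) : const δ a * f = a • f := by
  have h : ∀ g : D[X], mulFun δ (Polynomial.C a) g = a • g := by
    intro g
    rw [← monomial_zero_left, mulFun_monomial, Function.iterate_zero_apply, Polynomial.C_mul']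
  exact h f

theorem t_mul (f : DiffPoly δ) : t δ * f = ofPoly δ (tMul δ (toPoly f)) := by
  have h : ∀ g : D[X], mulFun δ X g = tMul δ g := by
    intro g
    rw [← monomial_one_one_eq_X, mulFun_monomial, Function.iterate_one, C_1, one_mul]
  exact h f

/-- The defining relation `t a = a t + δ(a)`. -/
theorem t_mul_const (a : D) : t δ * const δ a = const δ a * t δ + const δ (δ a) := by
  rw [t_mul, const_mul]
  have h := tMul_monomial δ 0 a
  rw [monomial_zero_left, monomial_zero_left, zero_add, ← C_mul_X_eq_monomial,
    Polynomial.C_mul'] at h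
  exact h

/-- The map `G_{τ,a} : ∑ bᵢ tⁱ ↦ ∑ τ(bᵢ) (t + a)ⁱ` on `D[t;δ]`. -/
noncomputable def G (τ : D ≃+* D) (a : D) (f : DiffPoly δ) : DiffPoly δ :=
  (toPoly f).sum fun i b => const δ (τ b) * (t δ + const δ a) ^ i

theorem coeff_coeffDer (h : D[X]) (n : ℕ) : (coeffDer δ h).coeff n = δ (h.coeff n) := by
  induction h using Polynomial.induction_on' with
  | add p q hp hq => rw [map_add, coeff_add, hp, hq, coeff_add, map_add]
  | monomial k b =>
    rw [coeffDer_monomial, coeff_monomial, coeff_monomial]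
    split_ifs <;> simp

theorem coeff_iterate_tMul (k : ℕ) (h : D[X]) (N : ℕ) (hN : h.natDegree ≤ N) :
    ((tMul δ)^[k] h).natDegree ≤ N + k ∧ ((tMul δ)^[k] h).coeff (N + k) = h.coeff N := by
  induction k with
  | zero => exact ⟨hN, rfl⟩
  | succ k ih =>
    rw [Function.iterate_succ_apply']
    obtain ⟨h1, h2⟩ := ih
    generalize (tMul δ)^[k] h = u at h1 h2 ⊢
    have hc : ∀ n, (tMul δ u).coeff (n + 1) = u.coeff n + δ (u.coeff (n + 1)) := by
      intro n
      rw [tMul_apply, coeff_add, coeff_mul_X, coeff_coeffDer]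
    rw [natDegree_le_iff_coeff_eq_zero] at h1 ⊢
    constructor
    · intro n hn
      obtain ⟨n, rfl⟩ : ∃ j, n = j + 1 := ⟨n - 1, by omega⟩
      rw [hc, h1 n (by omega), h1 (n + 1) (by omega), map_zero, add_zero]
    · rw [← add_assoc, hc, h2, h1 (N + k + 1) (by omega), map_zero, add_zero]

theorem coeff_mulFun (f g : D[X]) (M N : ℕ) (hM : f.natDegree ≤ M) (hN : g.natDegree ≤ N) :
    (mulFun δ f g).natDegree ≤ M + N ∧
      (mulFun δ f g).coeff (M + N) = f.coeff M * g.coeff N := by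
  have hs : mulFun δ f g
      = ∑ i ∈ Finset.range (M + 1), Polynomial.C (f.coeff i) * (tMul δ)^[i] g :=
    Polynomial.sum_over_range' f (by simp) (M + 1) (by omega)
  have hv : ∀ i n, N + i < n → ((tMul δ)^[i] g).coeff n = 0 := fun i n hn =>
    natDegree_le_iff_coeff_eq_zero.1 (coeff_iterate_tMul δ i g N hN).1 n hn
  constructor
  · rw [natDegree_le_iff_coeff_eq_zero]
    intro n hn
    rw [hs, finsetSum_coeff]
    refine Finset.sum_eq_zero fun i hi => ?_
    rw [Finset.mem_range] at hi
    rw [coeff_C_mul, hv i n (by omega), mul_zero]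
  · rw [hs, finsetSum_coeff, Finset.sum_eq_single M]
    · rw [coeff_C_mul, add_comm M N, (coeff_iterate_tMul δ M g N hN).2]
    · intro i hi hne
      rw [Finset.mem_range] at hi
      rw [coeff_C_mul, hv i (M + N) (by omega), mul_zero]
    · intro h
      simp at h

end Multiplication

section Division

variable {D : Type*} [DivisionRing D] {δ : RingDerivation D}

/-- Existence in the right division algorithm. -/
theorem exists_rightDivision (f g : DiffPoly δ) (hf : f ≠ 0) :
    ∃ q r : DiffPoly δ, g = q * f + r ∧ (toPoly r).degree < (toPoly f).degree := by
  have hf' : toPoly f ≠ 0 := hf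
  have main : ∀ (N : ℕ) (g : D[X]), g.degree < N → ∃ q r : D[X],
      g = mulFun δ q (toPoly f) + r ∧ r.degree < (toPoly f).degree := by
    generalize toPoly f = f at hf'
    intro N
    induction N with
    | zero =>
      intro g hg
      have : g = 0 := by
        rw [← degree_eq_bot]
        exact Nat.WithBot.lt_zero_iff.1 hg
      refine ⟨0, 0, ?_, ?_⟩
      · rw [this, mulFun_zero_left, add_zero]
      · rw [degree_zero]
        exact bot_lt_iff_ne_bot.2 (mt degree_eq_bot.1 hf')
    | succ N ih =>
      intro g hg
      by_cases hd : g.degree < f.degree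
      · exact ⟨0, g, by rw [mulFun_zero_left, zero_add], hd⟩
      · have hfN : f.natDegree ≤ N := by
          have h1 := lt_of_le_of_lt (not_lt.1 hd) hg
          rw [degree_eq_natDegree hf'] at h1
          have h2 : f.natDegree < N + 1 := by exact_mod_cast h1
          omega
        have hgN : g.natDegree ≤ N := natDegree_le_iff_degree_le.2 (by
          refine Order.le_of_lt_succ ?_
          exact hg)
        set q₁ : D[X] := monomial (N - f.natDegree) (g.coeff N * f.leadingCoeff⁻¹) with hq₁
        obtain ⟨h1, h2⟩ := coeff_mulFun δ q₁ f (N - f.natDegree) f.natDegree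
          (natDegree_monomial_le _) le_rfl
        rw [Nat.sub_add_cancel hfN] at h1 h2
        have h3 : (mulFun δ q₁ f).coeff N = g.coeff N := by
          rw [h2, hq₁, coeff_monomial, if_pos rfl, coeff_natDegree, mul_assoc,
            inv_mul_cancel₀ (leadingCoeff_ne_zero.2 hf'), mul_one]
        have h4 : (g - mulFun δ q₁ f).degree < N := by
          rw [degree_lt_iff_coeff_zero]
          intro n hn
          rw [coeff_sub]
          rcases hn.eq_or_lt with rfl | hn
          · rw [h3, sub_self]
          · rw [natDegree_le_iff_coeff_eq_zero.1 hgN n hn,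
              natDegree_le_iff_coeff_eq_zero.1 h1 n hn, sub_zero]
        obtain ⟨q₂, r, h5, h6⟩ := ih _ h4
        refine ⟨q₁ + q₂, r, ?_, h6⟩
        rw [mulFun_add_left, add_assoc, ← h5]
        abel
  obtain ⟨q, r, h1, h2⟩ := main ((toPoly g).natDegree + 1) (toPoly g) (by
    refine lt_of_le_of_lt degree_le_natDegree ?_
    exact_mod_cast Nat.lt_succ_self _)
  exact ⟨q, r, h1, h2⟩

/-- Uniqueness of the remainder in the right division algorithm. -/
theorem rightDivision_unique (f q q' r r' : DiffPoly δ) (h : q * f + r = q' * f + r')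
    (hr : (toPoly r).degree < (toPoly f).degree)
    (hr' : (toPoly r').degree < (toPoly f).degree) : r = r' := by
  have hf : toPoly f ≠ 0 := by
    intro h0
    rw [h0, degree_zero] at hr
    exact not_lt_bot hr
  have h1 : (q - q') * f = r' - r := by
    rw [sub_mul, sub_eq_sub_iff_add_eq_add, add_comm r']
    rw [h, add_comm]
  have h2 : mulFun δ (toPoly (q - q')) (toPoly f) = toPoly r' - toPoly r := h1
  obtain ⟨_, h4⟩ := coeff_mulFun δ (toPoly (q - q')) (toPoly f) _ _ le_rfl le_rfl
  have h5 : (toPoly r' - toPoly r).degree < (toPoly f).degree :=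
    (degree_sub_le _ _).trans_lt (max_lt hr' hr)
  rw [degree_eq_natDegree hf] at h5
  rw [h2, coeff_natDegree, coeff_natDegree,
    coeff_eq_zero_of_degree_lt (h5.trans_le (by exact_mod_cast Nat.le_add_left _ _))] at h4
  have h6 : toPoly (q - q') = 0 := by
    rcases mul_eq_zero.1 h4.symm with h | h
    · exact leadingCoeff_eq_zero.1 h
    · exact absurd (leadingCoeff_eq_zero.1 h) hf
  rw [h6, mulFun_zero_left] at h2
  exact (sub_eq_zero.1 h2.symm).symm

open Classical in
/-- The remainder `g mod_r f` of the right division of `g` by `f`: the unique `r` with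
`deg r < deg f` and `g = q f + r` for some `q` (and `0` if `f = 0`). -/
noncomputable def modRight (g f : DiffPoly δ) : DiffPoly δ :=
  if hf : f = 0 then 0 else (exists_rightDivision f g hf).choose_spec.choose

theorem modRight_spec (g f : DiffPoly δ) (hf : f ≠ 0) :
    (∃ q, g = q * f + modRight g f) ∧ (toPoly (modRight g f)).degree < (toPoly f).degree := by
  rw [modRight, dif_neg hf]
  have h := (exists_rightDivision f g hf).choose_spec.choose_spec
  exact ⟨⟨_, h.1⟩, h.2⟩

theorem modRight_eq {f g q r : DiffPoly δ} (h : g = q * f + r)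
    (hr : (toPoly r).degree < (toPoly f).degree) : modRight g f = r := by
  have hf : f ≠ 0 := by
    rintro rfl
    exact not_lt_bot (show (toPoly r).degree < ⊥ by
      have h0 : (toPoly (0 : DiffPoly δ)).degree = ⊥ := degree_zero
      rwa [h0] at hr)
  obtain ⟨⟨q', h1⟩, h2⟩ := modRight_spec g f hf
  exact rightDivision_unique f q' q _ _ (h1.symm.trans h) h2 hr

theorem modRight_add (f g h : DiffPoly δ) :
    modRight (g + h) f = modRight g f + modRight h f := by
  by_cases hf : f = 0
  · simp [modRight, hf]
  · obtain ⟨⟨q, h1⟩, h2⟩ := modRight_spec g f hf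
    obtain ⟨⟨q', h3⟩, h4⟩ := modRight_spec h f hf
    refine modRight_eq (q := q + q') ?_ ?_
    · conv_lhs => rw [h1, h3]
      rw [add_mul]
      abel
    · exact (degree_add_le _ _).trans_lt (max_lt h2 h4)

theorem modRight_zero (f : DiffPoly δ) : modRight 0 f = 0 := by
  have h := modRight_add f 0 0
  simpa using h

theorem modRight_smul (a : D) (f g : DiffPoly δ) : modRight (a • g) f = a • modRight g f := by
  by_cases hf : f = 0
  · simp [modRight, hf]
  · obtain ⟨⟨q, h1⟩, h2⟩ := modRight_spec g f hf
    refine modRight_eq (q := a • q) ?_ ?_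
    · conv_lhs => rw [h1]
      rw [smul_add, ← const_mul, ← const_mul, ← const_mul, mul_assoc]
    · exact (degree_smul_le _ _).trans_lt h2

end Division

end DiffPoly

open Polynomial in
/-- The underlying space `R_m = {g ∈ D[t;δ] : deg g < m}`, `m = deg f`, of the Petit algebra
`S_f`. The alternative `g = 0` only matters for `f = 0`, since `deg 0 = -∞`. -/
def petitSubmodule {D : Type*} [DivisionRing D] {δ : RingDerivation D} (f : DiffPoly δ) :
    Submodule D (DiffPoly δ) where
  carrier := {g | g.toPoly.degree < f.toPoly.degree ∨ g = 0}
  add_mem' := by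
    rintro x y (hx | rfl) (hy | rfl)
    · exact Or.inl ((degree_add_le _ _).trans_lt (max_lt hx hy))
    · exact Or.inl (by rwa [add_zero])
    · exact Or.inl (by rwa [zero_add])
    · exact Or.inr (add_zero 0)
  zero_mem' := Or.inr rfl
  smul_mem' := by
    rintro a x (hx | rfl)
    · exact Or.inl ((degree_smul_le _ _).trans_lt hx)
    · exact Or.inr (smul_zero a)

/-- The Petit algebra `S_f`: the space `R_m` of differential polynomials of degree less than
`m = deg f`, with the multiplication `g ∘ h = g h mod_r f`. -/
def PetitAlgebra {D : Type*} [DivisionRing D] {δ : RingDerivation D} (f : DiffPoly δ) : Type _ :=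
  petitSubmodule f

namespace PetitAlgebra

variable {D : Type*} [DivisionRing D] {δ : RingDerivation D} {f : DiffPoly δ}

/-- An element of `S_f` as an element of `D[t;δ]`. -/
def val (x : PetitAlgebra f) : DiffPoly δ := Subtype.val (p := (· ∈ petitSubmodule f)) x

theorem val_injective : Function.Injective (val : PetitAlgebra f → DiffPoly δ) :=
  Subtype.val_injective

noncomputable instance : AddCommGroup (PetitAlgebra f) :=
  inferInstanceAs (AddCommGroup (petitSubmodule f))

noncomputable instance : Module D (PetitAlgebra f) :=
  inferInstanceAs (Module D (petitSubmodule f))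

theorem modRight_mem (f g : DiffPoly δ) : DiffPoly.modRight g f ∈ petitSubmodule f := by
  by_cases hf : f = 0
  · exact Or.inr (by simp [DiffPoly.modRight, hf])
  · exact Or.inl (DiffPoly.modRight_spec g f hf).2

noncomputable instance : Mul (PetitAlgebra f) :=
  ⟨fun x y => (⟨DiffPoly.modRight (x.val * y.val) f, modRight_mem f _⟩ : petitSubmodule f)⟩

theorem val_mul (x y : PetitAlgebra f) : (x * y).val = DiffPoly.modRight (x.val * y.val) f := rfl

theorem val_add (x y : PetitAlgebra f) : (x + y).val = x.val + y.val := rfl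

theorem val_zero : (0 : PetitAlgebra f).val = 0 := rfl

theorem val_smul (a : D) (x : PetitAlgebra f) : (a • x).val = a • x.val := rfl

noncomputable instance : NonUnitalNonAssocRing (PetitAlgebra f) where
  __ := (inferInstance : AddCommGroup (PetitAlgebra f))
  left_distrib x y z := val_injective (by
    simp only [val_add, val_mul, mul_add, DiffPoly.modRight_add])
  right_distrib x y z := val_injective (by
    simp only [val_add, val_mul, add_mul, DiffPoly.modRight_add])
  zero_mul x := val_injective (by simp only [val_mul, val_zero, zero_mul, DiffPoly.modRight_zero])
  mul_zero x := val_injective (by simp only [val_mul, val_zero, mul_zero, DiffPoly.modRight_zero])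

end PetitAlgebra

namespace RingDerivation

variable (C : Type*) {D : Type*} [Field C] [DivisionRing D] [Algebra C D] [Algebra.IsCentral C D]
  (δ : RingDerivation D)

theorem exists_center (c : C) : ∃ c' : C, algebraMap C D c' = δ (algebraMap C D c) := by
  have h : δ (algebraMap C D c) ∈ Subalgebra.center C D := by
    rw [Subalgebra.mem_center_iff]
    intro x
    have h1 := δ.leibniz (algebraMap C D c) x
    have h2 := δ.leibniz x (algebraMap C D c)
    rw [← Algebra.commutes c x] at h2
    rw [h2, ← Algebra.commutes c (δ x), add_comm] at h1
    exact add_left_cancel h1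
  exact Algebra.mem_bot.1 (Algebra.IsCentral.out h)

/-- The map underlying `δ|_C`: the unique `c' ∈ C` whose image in `D` is `δ(c)`. -/
noncomputable def centerFun (c : C) : C := (exists_center C δ c).choose

theorem algebraMap_centerFun (c : C) :
    algebraMap C D (centerFun C δ c) = δ (algebraMap C D c) :=
  (exists_center C δ c).choose_spec

/-- The restriction `δ|_C` of a derivation of `D` to the center `C` of `D`. -/
noncomputable def centerDer : Derivation ℤ C C :=
  Derivation.mk'
    (AddMonoidHom.toIntLinearMap
      { toFun := centerFun C δ
        map_zero' := (algebraMap C D).injective (by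
          rw [algebraMap_centerFun, map_zero, map_zero])
        map_add' := fun x y => (algebraMap C D).injective (by
          rw [map_add, algebraMap_centerFun, algebraMap_centerFun, algebraMap_centerFun, map_add,
            map_add]) })
    (fun x y => (algebraMap C D).injective (by
      change algebraMap C D (centerFun C δ (x * y))
        = algebraMap C D (x * centerFun C δ y + y * centerFun C δ x)
      rw [map_add, map_mul, map_mul, algebraMap_centerFun, algebraMap_centerFun,
        algebraMap_centerFun, map_mul, leibniz, Algebra.commutes y]))

theorem algebraMap_centerDer (c : C) :
    algebraMap C D (centerDer C δ c) = δ (algebraMap C D c) :=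
  algebraMap_centerFun C δ c

/-- The field of constants `F = {c ∈ C : δ(c) = 0}`. -/
noncomputable def constField : Subfield C where
  carrier := {c | centerDer C δ c = 0}
  mul_mem' {x y} hx hy := by
    have hx' : centerDer C δ x = 0 := hx
    have hy' : centerDer C δ y = 0 := hy
    simp [hx', hy']
  one_mem' := by simp
  add_mem' {x y} hx hy := by
    have hx' : centerDer C δ x = 0 := hx
    have hy' : centerDer C δ y = 0 := hy
    simp [hx', hy']
  zero_mem' := by simp
  neg_mem' {x} hx := by
    have hx' : centerDer C δ x = 0 := hx
    simp [hx']
  inv_mem' x hx := by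
    have hx' : centerDer C δ x = 0 := hx
    simp [Derivation.leibniz_inv, hx']

/-- `δ|_C` as an `F`-linear endomorphism of `C`. -/
noncomputable def centerEnd : Module.End (constField C δ) C where
  toFun := centerDer C δ
  map_add' := map_add _
  map_smul' a x := by
    have ha : centerDer C δ (a : C) = 0 := a.2
    simp [Subfield.smul_def, ha]

/-- The embedding of the field of constants `F` into `D`. -/
noncomputable def constEmb : constField C δ →+* D :=
  (algebraMap C D).comp (constField C δ).subtype

variable (p : ℕ) [Fact p.Prime] [CharP C p]

/-- The additive map `V_{p^j}` on `C`, characterized by `(t - b)^(p^j) = t^(p^j) - V_{p^j}(b)`: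
`V_{p^j}(b) = ∑_{i ≤ j} (δ^{p^i - 1}(b))^{p^{j-i}}`. In particular `V_1(b) = b` and
`V_p(b) = b^p + δ^{p-1}(b)`. -/
noncomputable def Vpow (j : ℕ) : C →+ C where
  toFun b := ∑ i ∈ Finset.range (j + 1), ((centerDer C δ)^[p ^ i - 1] b) ^ p ^ (j - i)
  map_zero' := Finset.sum_eq_zero fun i _ => by
    rw [iterate_map_zero, zero_pow (pow_ne_zero _ (Fact.out : p.Prime).ne_zero)]
  map_add' x y := by
    rw [← Finset.sum_add_distrib]
    refine Finset.sum_congr rfl fun i _ => ?_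
    rw [iterate_map_add, add_pow_char_pow]

/-- The map `V = V_g` on `C` for the `p`-polynomial
`g(t) = t^{p^e} + a₁ t^{p^{e-1}} + ⋯ + a_e t` over `F`:
`V(b) = V_{p^e}(b) + a₁ V_{p^{e-1}}(b) + ⋯ + a_e b`. -/
noncomputable def V (e : ℕ) (a : ℕ → constField C δ) : C →+ C :=
  Vpow C δ p e + ∑ i ∈ Finset.Icc 1 e, (AddMonoidHom.mulLeft (a i : C)).comp (Vpow C δ p (e - i))

end RingDerivation

namespace PetitAlgebra

variable (C : Type*) {D : Type*} [Field C] [DivisionRing D] [Algebra C D] [Algebra.IsCentral C D]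
  {δ : RingDerivation D}

noncomputable instance (f : DiffPoly δ) : Module (δ.constField C) (PetitAlgebra f) :=
  Module.compHom _ (δ.constEmb C)

variable {C} in
theorem constField_smul_def {f : DiffPoly δ} (a : δ.constField C) (x : PetitAlgebra f) :
    a • x = δ.constEmb C a • x := rfl

open Polynomial in
variable {C} in
theorem const_commute (a : δ.constField C) (x : DiffPoly δ) :
    x * DiffPoly.const δ (δ.constEmb C a) = DiffPoly.const δ (δ.constEmb C a) * x := by
  have hδ : δ (δ.constEmb C a) = 0 := by
    have h : δ.centerDer C (a : C) = 0 := a.2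
    change δ (algebraMap C D (a : C)) = 0
    rw [← RingDerivation.algebraMap_centerDer, h, map_zero]
  have hc : ∀ b : D, b * δ.constEmb C a = δ.constEmb C a * b := fun b =>
    (Algebra.commutes (a : C) b).symm
  generalize δ.constEmb C a = u at hδ hc ⊢
  have main : ∀ g : D[X], DiffPoly.mulFun δ g (Polynomial.C u) = u • g := by
    intro g
    induction g using Polynomial.induction_on' with
    | add p q hp hq => rw [DiffPoly.mulFun_add_left, hp, hq, smul_add]
    | monomial n b =>
      have key : ∀ k : ℕ, (DiffPoly.tMul δ)^[k] (Polynomial.C u) = monomial k u := by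
        intro k
        induction k with
        | zero => simp
        | succ k ih =>
          rw [Function.iterate_succ_apply', ih, DiffPoly.tMul_monomial, hδ]
          simp
      rw [DiffPoly.mulFun_monomial, key n, C_mul_monomial, hc, smul_monomial, smul_eq_mul]
  rw [DiffPoly.const_mul]
  exact main x

instance (f : DiffPoly δ) : IsScalarTower (δ.constField C) (PetitAlgebra f) (PetitAlgebra f) where
  smul_assoc a x y := val_injective (by
    simp only [smul_eq_mul, constField_smul_def, val_smul, val_mul, ← DiffPoly.const_mul,
      mul_assoc]
    rw [DiffPoly.const_mul, DiffPoly.const_mul, DiffPoly.modRight_smul])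

instance (f : DiffPoly δ) : SMulCommClass (δ.constField C) (PetitAlgebra f) (PetitAlgebra f) where
  smul_comm a x y := val_injective (by
    simp only [smul_eq_mul, constField_smul_def, val_smul, val_mul, ← DiffPoly.const_mul]
    rw [← mul_assoc, const_commute, mul_assoc, DiffPoly.const_mul, DiffPoly.const_mul,
      DiffPoly.modRight_smul])

/-- The group `Aut_F(S_f)` of `F`-algebra automorphisms of `S_f`: the multiplicative bijective
`F`-linear maps `S_f → S_f`, under composition. -/
def autF (f : DiffPoly δ) :
    Subgroup (PetitAlgebra f ≃ₗ[δ.constField C] PetitAlgebra f) where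
  carrier := {φ | ∀ x y, φ (x * y) = φ x * φ y}
  mul_mem' {φ ψ} hφ hψ x y := by
    rw [LinearEquiv.mul_apply, LinearEquiv.mul_apply, LinearEquiv.mul_apply, hψ x y, hφ]
  one_mem' _ _ := rfl
  inv_mem' {φ} hφ x y := φ.injective (by
    have h : ∀ z, φ (φ⁻¹ z) = z := φ.apply_symm_apply
    rw [hφ, h, h, h])

end PetitAlgebra

/-!
Jacobson's formula for `(x + y) ^ p` gives `(t - b) ^ p ^ j = t ^ p ^ j - V_{p^j}(b)` by induction
on `j`, because `t ^ p ^ j` acts by commutators on `C` as `δ ^ p ^ j`. Summing these relations, the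
shift `t ↦ t - b` sends `g(t)` to `g(t) - V(b)`. If `V(b) = 0`, it therefore fixes `f = g - d`, and
it preserves degrees, so it commutes with taking remainders modulo `f`.

Reading the same relation in `End_F(C)`, with `t` acting as `δ`, gives `g(δ - b) = -V(b)`. The
polynomial `g` has no constant term, so `δ - b` with a nonzero kernel forces `V(b) = 0`. Conversely,
no nonzero `h ∈ C[t;δ]` of degree less than `deg g` acts on `C` as zero: the commutator with `t` of
a monic such `h` also acts as zero and has smaller degree, so for `h` of minimal degree it vanishes
and `h` has coefficients in `F`, against the minimality of `g`. If `V(b) = 0` and `δ - b` were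
injective, then writing `g = X q` the element `q(t - b)` would act as zero.
-/

section Jacobson

open Polynomial LieAlgebra

attribute [local instance] LieRing.ofAssociativeRing

variable {R : Type*} [Ring R] (p : ℕ) [Fact p.Prime] [CharP R p]

theorem natCast_choose_char_sub_one {k : ℕ} (hk : k < p) :
    ((p - 1).choose k : R) = (-1) ^ k := by
  induction k with
  | zero => simp
  | succ k ih =>
    have hp : p.Prime := Fact.out
    have hpascal : ((p.choose (k + 1) : ℕ) : R) = (p - 1).choose k + (p - 1).choose (k + 1) := by
      rw [← Nat.cast_add, ← Nat.choose_succ_succ', Nat.sub_add_cancel hp.one_le]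
    rw [(CharP.cast_eq_zero_iff R p _).2 (hp.dvd_choose_self k.succ_ne_zero hk),
      ih (k.lt_succ_self.trans hk)] at hpascal
    rw [pow_succ, mul_neg_one]
    exact (neg_eq_of_add_eq_zero_right hpascal.symm).symm

variable {p} in
theorem sub_pow_char_sub_one_of_commute {a b : R} (h : Commute a b) :
    (a - b) ^ (p - 1) = ∑ i ∈ Finset.range p, a ^ i * b ^ (p - 1 - i) := by
  have hp : p.Prime := Fact.out
  rw [sub_eq_add_neg, h.neg_right.add_pow, Nat.sub_add_cancel hp.one_le]
  refine Finset.sum_congr rfl fun i hi => ?_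
  have hi : i < p := Finset.mem_range.1 hi
  have hsign : (-1 : R) ^ (p - 1 - i) * (-1) ^ i = 1 := by
    rw [← pow_add, Nat.sub_add_cancel (Nat.le_sub_one_of_lt hi),
      ← natCast_choose_char_sub_one p (Nat.sub_one_lt hp.ne_zero), Nat.choose_self, Nat.cast_one]
  rw [natCast_choose_char_sub_one p hi, neg_pow b, mul_assoc, mul_assoc,
    ((Commute.neg_one_left b).pow_pow i _).symm.eq, ← mul_assoc (_ ^ _) (_ ^ i), hsign, one_mul]

omit [Fact p.Prime] [CharP R p] in
theorem derivative_pow_eq_sum (y : R[X]) (n : ℕ) :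
    derivative (y ^ n) = ∑ i ∈ Finset.range n, y ^ i * derivative y * y ^ (n - 1 - i) := by
  induction n with
  | zero => simp
  | succ n ih =>
    rw [pow_succ', derivative_mul, ih, Finset.sum_range_succ', Finset.mul_sum, add_comm]
    congr 1
    · refine Finset.sum_congr rfl fun i _ => ?_
      rw [Nat.add_sub_cancel, Nat.sub_sub, add_comm 1 i, pow_succ']
      simp only [mul_assoc]
    · simp

theorem derivative_pow_char (y : R[X]) :
    derivative (y ^ p) = (ad ℤ R[X] y ^ (p - 1)) (derivative y) := by
  have : CharP (Module.End ℤ R[X]) p :=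
    charP_of_injective_ringHom (f := (Algebra.lmul ℤ R[X]).toRingHom) Algebra.lmul_injective p
  rw [ad_eq_lmul_left_sub_lmul_right, Pi.sub_apply,
    sub_pow_char_sub_one_of_commute (LinearMap.commute_mulLeft_right y y), derivative_pow_eq_sum,
    LinearMap.sum_apply]
  simp only [LinearMap.pow_mulLeft, LinearMap.pow_mulRight, Module.End.mul_apply,
    LinearMap.mulLeft_apply, LinearMap.mulRight_apply, mul_assoc]

theorem eq_of_derivative_eq_C {q : R[X]} {v : R} (hdeg : q.natDegree ≤ p)
    (hq : derivative q = C v) : q = C (q.coeff 0) + C v * X + C (q.coeff p) * X ^ p := by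
  have hp : p.Prime := Fact.out
  have hcoeff : ∀ k, q.coeff (k + 1) * ((k + 1 : ℕ) : R) = if k = 0 then v else 0 := fun k => by
    rw [← coeff_C, ← hq, coeff_derivative, Nat.cast_succ]
  ext (_ | _ | k)
  · simp [hp.ne_zero.symm]
  · have := hcoeff 0
    simpa [coeff_X_pow, hp.one_lt.ne] using this
  · rw [coeff_add, coeff_add, coeff_C_mul, coeff_X_of_ne_one (by omega), mul_zero,
      coeff_C_succ, zero_add, zero_add, coeff_C_mul, coeff_X_pow]
    rcases lt_trichotomy (k + 1 + 1) p with h | rfl | h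
    · have hunit : IsUnit ((k + 1 + 1 : ℕ) : R) :=
        (CharP.isUnit_natCast_iff hp).2 (Nat.not_dvd_of_pos_of_lt (Nat.succ_pos _) h)
      rw [if_neg h.ne, mul_zero]
      exact hunit.mul_left_eq_zero.1 (hcoeff (k + 1))
    · rw [if_pos rfl, mul_one]
    · rw [coeff_eq_zero_of_natDegree_lt (hdeg.trans_lt h), if_neg h.ne', mul_zero]

theorem add_pow_char_of_commute_ad {x c : R}
    (hc : ∀ k, Commute c ((ad ℤ R x ^ k) c)) :
    (x + c) ^ p = x ^ p + c ^ p + (ad ℤ R x ^ (p - 1)) c := by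
  set y : R[X] := C x + C c * X with hy
  have hdeg : y.natDegree ≤ 1 := by
    rw [hy, add_comm]
    exact natDegree_linear_le
  have had : ∀ k, (ad ℤ R[X] y ^ k) (C c) = C ((ad ℤ R x ^ k) c) := fun k => by
    induction k with
    | zero => rfl
    | succ k ih =>
      rw [pow_succ', pow_succ', Module.End.mul_apply, Module.End.mul_apply, ih, ad_apply, ad_apply,
        Ring.lie_def, Ring.lie_def, hy, add_mul, mul_add, mul_assoc, X_mul_C, ← mul_assoc,
        ← mul_assoc, ← C_mul, ← C_mul, ← C_mul, ← C_mul, (hc k).eq, C_sub, add_sub_add_right_eq_sub]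
  have hder : derivative (y ^ p) = C ((ad ℤ R x ^ (p - 1)) c) := by
    rw [derivative_pow_char, ← had]
    simp [hy]
  have heval : ∀ r : R, (∀ a, Commute a r) → eval r (y ^ p) = eval r y ^ p := fun r hr =>
    map_pow (eval₂RingHom' (RingHom.id R) r hr) y p
  have hconst : (y ^ p).coeff 0 = x ^ p := by
    rw [coeff_zero_eq_eval_zero, heval 0 Commute.zero_right, hy]
    simp
  have hlead : (y ^ p).coeff p = c ^ p := by
    have := coeff_pow_of_natDegree_le (m := p) hdeg
    rw [mul_one] at this
    rw [this, hy]
    simp [coeff_C]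
  have hsum := eq_of_derivative_eq_C p
    ((natDegree_pow_le_of_le p hdeg).trans_eq (mul_one p)) hder
  have hone := heval 1 Commute.one_right
  rw [hsum, hconst, hlead, hy] at hone
  rw [add_right_comm]
  simpa only [eval_add, eval_C, eval_C_mul, eval_X, eval_X_pow, one_pow, mul_one] using hone.symm

theorem lie_pow_char_pow (x y : R) (j : ℕ) : ⁅x ^ p ^ j, y⁆ = (ad ℤ R x ^ p ^ j) y := by
  have : CharP (Module.End ℤ R) p :=
    charP_of_injective_ringHom (f := (Algebra.lmul ℤ R).toRingHom) Algebra.lmul_injective p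
  rw [ad_eq_lmul_left_sub_lmul_right, Pi.sub_apply,
    sub_pow_char_pow_of_commute _ _ (LinearMap.commute_mulLeft_right x x), LinearMap.pow_mulLeft,
    LinearMap.pow_mulRight, Ring.lie_def, LinearMap.sub_apply, LinearMap.mulLeft_apply,
    LinearMap.mulRight_apply]

section Intertwining

variable {A : Type*} [CommRing A] {φ : A →+* R} {x : R} {δ : A → A}

omit [Fact p.Prime] [CharP R p] in
theorem ad_pow_map_of_lie_map (hx : ∀ a, ⁅x, φ a⁆ = φ (δ a)) (n : ℕ) (a : A) :
    (ad ℤ R x ^ n) (φ a) = φ (δ^[n] a) := by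
  induction n with
  | zero => rfl
  | succ n ih =>
    rw [pow_succ', Module.End.mul_apply, ih, ad_apply, hx, Function.iterate_succ_apply']

theorem lie_pow_char_pow_map (hx : ∀ a, ⁅x, φ a⁆ = φ (δ a)) (j : ℕ) (a : A) :
    ⁅x ^ p ^ j, φ a⁆ = φ (δ^[p ^ j] a) := by
  rw [lie_pow_char_pow, ad_pow_map_of_lie_map hx]

theorem sub_map_pow_char (hx : ∀ a, ⁅x, φ a⁆ = φ (δ a)) (b : A) :
    (x - φ b) ^ p = x ^ p - φ (b ^ p + δ^[p - 1] b) := by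
  have had : ∀ n, (ad ℤ R x ^ n) (-φ b) = -φ (δ^[n] b) := fun n => by
    rw [map_neg, ad_pow_map_of_lie_map hx]
  have hcomm : ∀ n, Commute (-φ b) ((ad ℤ R x ^ n) (-φ b)) := fun n => by
    rw [had]
    exact ((Commute.all b _).map φ).neg_left.neg_right
  rw [sub_eq_add_neg, add_pow_char_of_commute_ad p hcomm, had, neg_pow (φ b), neg_one_pow_char,
    neg_one_mul, map_add, map_pow]
  abel

end Intertwining

end Jacobson

namespace RingDerivation

open Polynomial

section Vpow

variable (C : Type*) {D : Type*} [Field C] [DivisionRing D] [Algebra C D] [Algebra.IsCentral C D]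
  (δ : RingDerivation D) (p : ℕ) [Fact p.Prime] [CharP C p]

theorem Vpow_zero (b : C) : δ.Vpow C p 0 b = b := by
  simp [Vpow]

theorem Vpow_succ (j : ℕ) (b : C) :
    δ.Vpow C p (j + 1) b = δ.Vpow C p j b ^ p + (δ.centerDer C)^[p ^ (j + 1) - 1] b := by
  simp only [Vpow, AddMonoidHom.coe_mk, ZeroHom.coe_mk]
  rw [Finset.sum_range_succ, sum_pow_char, Nat.sub_self, pow_zero, pow_one]
  congr 1
  refine Finset.sum_congr rfl fun i hi => ?_
  have hij : i ≤ j := Finset.mem_range_succ_iff.1 hi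
  rw [← pow_mul, ← pow_succ, Nat.sub_add_comm hij]

omit [Fact p.Prime] in
theorem centerDer_pow_char (b : C) : δ.centerDer C (b ^ p) = 0 := by
  rw [Derivation.leibniz_pow, ← Nat.cast_smul_eq_nsmul C, CharP.cast_eq_zero, zero_smul]

theorem iterate_succ_centerDer_Vpow (j n : ℕ) (b : C) :
    (δ.centerDer C)^[n + 1] (δ.Vpow C p j b) = (δ.centerDer C)^[n + p ^ j] b := by
  cases j with
  | zero => rw [Vpow_zero, pow_zero]
  | succ j =>
    have hpos : 0 < p ^ (j + 1) := pow_pos (Fact.out : p.Prime).pos _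
    rw [Vpow_succ, iterate_map_add, Function.iterate_succ_apply, centerDer_pow_char,
      iterate_map_zero, zero_add, ← Function.iterate_add_apply, add_assoc, Nat.add_sub_cancel' hpos]

theorem centerDer_Vpow (j : ℕ) (b : C) :
    δ.centerDer C (δ.Vpow C p j b) = (δ.centerDer C)^[p ^ j] b := by
  simpa only [zero_add, Function.iterate_one] using iterate_succ_centerDer_Vpow C δ p j 0 b

theorem iterate_iterate_centerDer_Vpow (j : ℕ) (b : C) :
    ((δ.centerDer C)^[p ^ j])^[p - 1] (δ.Vpow C p j b) = (δ.centerDer C)^[p ^ (j + 1) - 1] b := by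
  have hp : p.Prime := Fact.out
  obtain ⟨n, hn⟩ : ∃ n, p ^ j * (p - 1) = n + 1 := Nat.exists_eq_succ_of_ne_zero
    (mul_ne_zero (pow_ne_zero _ hp.ne_zero) (Nat.sub_ne_zero_of_lt hp.one_lt))
  have hsplit : p ^ (j + 1) = p ^ j * (p - 1) + p ^ j := by
    rw [← Nat.mul_succ, Nat.succ_eq_add_one, Nat.sub_add_cancel hp.one_le, pow_succ]
  rw [← Function.iterate_mul, hn, iterate_succ_centerDer_Vpow, hsplit, hn, Nat.add_right_comm,
    Nat.add_sub_cancel]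

variable {C δ} {R : Type*} [Ring R] [Nontrivial R] {φ : C →+* R} {x : R}

theorem sub_map_pow_char_pow (hx : ∀ c, ⁅x, φ c⁆ = φ (δ.centerDer C c)) (j : ℕ) (b : C) :
    (x - φ b) ^ p ^ j = x ^ p ^ j - φ (δ.Vpow C p j b) := by
  have : CharP R p := charP_of_injective_ringHom φ.injective p
  induction j with
  | zero => simp only [pow_zero, pow_one, Vpow_zero]
  | succ j ih =>
    rw [pow_succ, pow_mul, ih, sub_map_pow_char p (lie_pow_char_pow_map p hx j), ← pow_mul,
      iterate_iterate_centerDer_Vpow, Vpow_succ]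

end Vpow

section PPolynomial

/-- The `p`-polynomial `X^{p^e} + a₁ X^{p^{e-1}} + ⋯ + a_e X`, the shape of the minimum
polynomial of `δ|_C`. Only the values `a 1, …, a e` matter. -/
noncomputable def pPolynomial {F : Type*} [CommRing F] (p e : ℕ) (a : ℕ → F) : F[X] :=
  X ^ p ^ e + ∑ i ∈ Finset.Icc 1 e, Polynomial.C (a i) * X ^ p ^ (e - i)

theorem degree_pPolynomial {F : Type*} [CommRing F] [Nontrivial F] {p : ℕ} (hp : 1 < p) (e : ℕ)
    (a : ℕ → F) : (pPolynomial p e a).degree = (p ^ e : ℕ) := by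
  have htail : (∑ i ∈ Finset.Icc 1 e, Polynomial.C (a i) * X ^ p ^ (e - i)).degree
      < ((p ^ e : ℕ) : WithBot ℕ) := by
    refine mem_degreeLT.1 (sum_mem fun i hi => mem_degreeLT.2 ?_)
    refine (degree_C_mul_X_pow_le _ _).trans_lt ?_
    have hi := Finset.mem_Icc.1 hi
    exact_mod_cast Nat.pow_lt_pow_right hp (by omega)
  rw [pPolynomial, degree_add_eq_left_of_degree_lt, degree_X_pow]
  rwa [degree_X_pow]

theorem eval₂_pPolynomial {F R : Type*} [CommRing F] [Ring R] (ψ : F →+* R) (x : R) (p e : ℕ)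
    (a : ℕ → F) : eval₂ ψ x (pPolynomial p e a) =
      x ^ p ^ e + ∑ i ∈ Finset.Icc 1 e, ψ (a i) * x ^ p ^ (e - i) := by
  rw [pPolynomial, eval₂_add, eval₂_finsetSum, X_pow_eq_monomial, eval₂_monomial, map_one, one_mul]
  simp only [C_mul_X_pow_eq_monomial, eval₂_monomial]

variable {C D : Type*} [Field C] [DivisionRing D] [Algebra C D] [Algebra.IsCentral C D]
  {δ : RingDerivation D} (p : ℕ) [Fact p.Prime] [CharP C p] (e : ℕ) (a : ℕ → δ.constField C)

theorem V_apply (b : C) : δ.V C p e a b =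
    δ.Vpow C p e b + ∑ i ∈ Finset.Icc 1 e, (a i : C) * δ.Vpow C p (e - i) b := by
  simp [V, AddMonoidHom.finsetSum_apply]

theorem V_exponent_zero (a : ℕ → δ.constField C) (b : C) : δ.V C p 0 a b = b := by
  simp [V_apply, Vpow_zero]

theorem eval₂_pPolynomial_sub_map {R : Type*} [Ring R] [Nontrivial R] {φ : C →+* R} {x : R}
    (hx : ∀ c, ⁅x, φ c⁆ = φ (δ.centerDer C c)) (b : C) :
    eval₂ (φ.comp (δ.constField C).subtype) (x - φ b) (pPolynomial p e a) =
      eval₂ (φ.comp (δ.constField C).subtype) x (pPolynomial p e a) - φ (δ.V C p e a b) := by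
  simp only [eval₂_pPolynomial, sub_map_pow_char_pow p hx, V_apply, RingHom.comp_apply,
    Subfield.subtype_apply, map_add, map_sum, map_mul, mul_sub, Finset.sum_sub_distrib]
  abel

theorem centerDer_V (b : C) :
    δ.centerDer C (δ.V C p e a b) = aeval (δ.centerEnd C) (pPolynomial p e a) b := by
  have hconst : ∀ i, δ.centerDer C (a i) = 0 := fun i => (a i).2
  have hpow : ∀ n, (δ.centerEnd C ^ n) b = (δ.centerDer C)^[n] b := fun n =>
    congrFun (Module.End.coe_pow (δ.centerEnd C) n) b
  rw [aeval_def, eval₂_pPolynomial, V_apply, map_add, map_sum]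
  simp [LinearMap.sum_apply, hconst, hpow, centerDer_Vpow, Subfield.smul_def]

theorem V_mem_constField (hg : aeval (δ.centerEnd C) (pPolynomial p e a) = 0) (b : C) :
    δ.V C p e a b ∈ δ.constField C := by
  change δ.centerDer C _ = 0
  rw [centerDer_V, hg, LinearMap.zero_apply]

end PPolynomial

end RingDerivation

namespace DiffPoly

open Polynomial

section UniversalProperty

variable {D : Type*} [Ring D] {δ : RingDerivation D}

variable (δ) in
/-- The embedding of the coefficient ring `D` into `D[t;δ]`. -/
noncomputable def constHom : D →+* DiffPoly δ where
  toFun := const δ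
  map_one' := C_1
  map_zero' := C_0
  map_add' _ _ := C_add
  map_mul' a b := by
    rw [const_mul]
    exact (smul_C (R := D) a b).symm

theorem constHom_injective : Function.Injective (constHom δ) := C_injective

theorem constHom_mul (a : D) (h : DiffPoly δ) : constHom δ a * h = a • h := const_mul δ a h

theorem lie_t_constHom (a : D) : ⁅t δ, constHom δ a⁆ = constHom δ (δ a) :=
  sub_eq_of_eq_add' (t_mul_const δ a)

theorem t_pow (n : ℕ) : t δ ^ n = ofPoly δ (X ^ n) := by
  induction n with
  | zero => rfl
  | succ n ih =>
    rw [pow_succ', ih, t_mul]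
    change ofPoly δ (tMul δ (X ^ n)) = _
    rw [X_pow_eq_monomial, tMul_monomial, δ.map_one_eq_zero, map_zero, add_zero, X_pow_eq_monomial]

theorem ofPoly_eq_eval₂ (q : D[X]) : ofPoly δ q = eval₂ (constHom δ) (t δ) q := by
  induction q using Polynomial.induction_on' with
  | add q r hq hr => rw [eval₂_add, ← hq, ← hr]; rfl
  | monomial n a =>
    rw [eval₂_monomial, t_pow, constHom_mul, ← C_mul_X_pow_eq_monomial, ← smul_eq_C_mul]
    rfl

variable {R : Type*} [Ring R]

theorem hom_ext {F G : DiffPoly δ →+* R} (hconst : F.comp (constHom δ) = G.comp (constHom δ))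
    (ht : F (t δ) = G (t δ)) : F = G := by
  refine RingHom.ext fun h => ?_
  change F (ofPoly δ (toPoly h)) = G (ofPoly δ (toPoly h))
  rw [ofPoly_eq_eval₂, hom_eval₂, hom_eval₂, ht, hconst]

variable {φ : D →+* R} {z : R}

theorem eval₂_iterate_tMul (hz : ∀ a, ⁅z, φ a⁆ = φ (δ a)) (n : ℕ) (q : D[X]) :
    eval₂ φ z ((tMul δ)^[n] q) = z ^ n * eval₂ φ z q := by
  have htMul : ∀ r : D[X], eval₂ φ z (tMul δ r) = z * eval₂ φ z r := fun r => by
    induction r using Polynomial.induction_on' with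
    | add r s hr hs => rw [map_add, eval₂_add, eval₂_add, mul_add, hr, hs]
    | monomial m a =>
      rw [tMul_monomial, eval₂_add, eval₂_monomial, eval₂_monomial, eval₂_monomial, ← hz,
        Ring.lie_def, sub_mul, pow_succ', mul_assoc, mul_assoc, add_sub_cancel]
  induction n with
  | zero => rw [Function.iterate_zero_apply, pow_zero, one_mul]
  | succ n ih => rw [Function.iterate_succ_apply', htMul, ih, pow_succ', mul_assoc]

theorem eval₂_mulFun (hz : ∀ a, ⁅z, φ a⁆ = φ (δ a)) (q r : D[X]) :
    eval₂ φ z (mulFun δ q r) = eval₂ φ z q * eval₂ φ z r := by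
  induction q using Polynomial.induction_on' with
  | add q s hq hs => rw [mulFun_add_left, eval₂_add, eval₂_add, add_mul, hq, hs]
  | monomial n a =>
    rw [mulFun_monomial, ← smul_eq_C_mul, eval₂_smul, eval₂_iterate_tMul hz, eval₂_monomial,
      mul_assoc]

/-- The universal property of `D[t;δ]`: a ring homomorphism `φ` on `D` and an element `z` whose
commutators with `φ(a)` are `φ(δ(a))` extend to the homomorphism `∑ aᵢ tⁱ ↦ ∑ φ(aᵢ) zⁱ`. -/
noncomputable def lift (φ : D →+* R) (z : R) (hz : ∀ a, ⁅z, φ a⁆ = φ (δ a)) :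
    DiffPoly δ →+* R where
  toFun h := eval₂ φ z (toPoly h)
  map_zero' := eval₂_zero φ z
  map_one' := eval₂_one φ z
  map_add' _ _ := eval₂_add φ z
  map_mul' g h := eval₂_mulFun hz (toPoly g) (toPoly h)

variable (hz : ∀ a, ⁅z, φ a⁆ = φ (δ a))

theorem lift_constHom (a : D) : lift φ z hz (constHom δ a) = φ a := eval₂_C φ z

theorem lift_t : lift φ z hz (t δ) = z := eval₂_X φ z

theorem lift_ofPoly (q : D[X]) : lift φ z hz (ofPoly δ q) = eval₂ φ z q := rfl

end UniversalProperty

section Shift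

variable {C D : Type*} [CommRing C] [Ring D] [Algebra C D] {δ : RingDerivation D}

variable (δ) in
/-- The central elements of `D` given by `C`, as elements of `D[t;δ]`. -/
noncomputable def centerHom : C →+* DiffPoly δ := (constHom δ).comp (algebraMap C D)

theorem centerHom_commute (b : C) (a : D) : Commute (centerHom δ b) (constHom δ a) :=
  (show Commute (algebraMap C D b) a from Algebra.commutes b a).map (constHom δ)

theorem lie_t_sub_centerHom (b : C) (a : D) :
    ⁅t δ - centerHom δ b, constHom δ a⁆ = constHom δ (δ a) := by
  rw [Ring.lie_def, sub_mul, mul_sub, (centerHom_commute b a).eq, sub_sub_sub_cancel_right,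
    ← Ring.lie_def, lie_t_constHom]

variable (δ) in
/-- The ring endomorphism `G_{id,-b}` of `D[t;δ]`, `t ↦ t - b`, for a central element `b`. -/
noncomputable def shift (b : C) : DiffPoly δ →+* DiffPoly δ :=
  lift (constHom δ) (t δ - centerHom δ b) (lie_t_sub_centerHom b)

theorem shift_eq_G (b : C) (h : DiffPoly δ) :
    shift δ b h = G δ (RingEquiv.refl D) (-algebraMap C D b) h := by
  change eval₂ _ _ _ = _
  rw [eval₂_eq_sum, sub_eq_add_neg, centerHom, RingHom.comp_apply, ← map_neg]
  rfl

theorem shift_constHom (b : C) (a : D) : shift δ b (constHom δ a) = constHom δ a :=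
  lift_constHom _ a

theorem shift_t (b : C) : shift δ b (t δ) = t δ - centerHom δ b := lift_t _

theorem shift_smul (b : C) (a : D) (h : DiffPoly δ) : shift δ b (a • h) = a • shift δ b h := by
  rw [← constHom_mul, map_mul, shift_constHom, constHom_mul]

theorem shift_shift (b c : C) (h : DiffPoly δ) : shift δ b (shift δ c h) = shift δ (b + c) h := by
  refine RingHom.congr_fun (hom_ext (F := (shift δ b).comp (shift δ c))
    (RingHom.ext fun a => ?_) ?_) h
  · simp only [RingHom.comp_apply, shift_constHom]
  · simp only [RingHom.comp_apply, shift_t, map_sub, centerHom, shift_constHom, map_add, sub_sub]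

theorem shift_zero (h : DiffPoly δ) : shift δ (0 : C) h = h := by
  refine RingHom.congr_fun (hom_ext (G := RingHom.id _) (RingHom.ext (shift_constHom 0)) ?_) h
  rw [shift_t, map_zero, sub_zero, RingHom.id_apply]

theorem shift_injective (b : C) : Function.Injective (shift δ b) :=
  Function.LeftInverse.injective (g := shift δ (-b)) fun h => by
    rw [shift_shift, neg_add_cancel, shift_zero]

theorem natDegree_pow_le {z : DiffPoly δ} (hz : (toPoly z).natDegree ≤ 1) (n : ℕ) :
    (toPoly (z ^ n)).natDegree ≤ n := by
  induction n with
  | zero => exact natDegree_one.le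
  | succ n ih => exact pow_succ z n ▸ (coeff_mulFun δ _ _ n 1 ih hz).1

theorem degree_shift_lt (b : C) {n : ℕ} {h : DiffPoly δ} (hn : (toPoly h).degree < n) :
    (toPoly (shift δ b h)).degree < n := by
  have hlinear : (toPoly (t δ - centerHom δ b)).natDegree ≤ 1 :=
    natDegree_sub_le_of_le natDegree_X_le ((natDegree_C _).le.trans zero_le_one)
  rw [← mem_degreeLT]
  change eval₂ (constHom δ) (t δ - centerHom δ b) (toPoly h) ∈ degreeLT D n
  rw [eval₂_eq_sum, Polynomial.sum]
  refine Submodule.sum_mem (degreeLT D n) fun i hi => ?_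
  rw [constHom_mul]
  refine Submodule.smul_mem (degreeLT D n) _ (mem_degreeLT.2 ?_)
  exact (degree_le_of_natDegree_le (natDegree_pow_le hlinear i)).trans_lt
    ((le_degree_of_mem_supp i hi).trans_lt hn)

theorem degree_shift_lt_degree (b : C) {f g : DiffPoly δ}
    (hg : (toPoly g).degree < (toPoly f).degree) :
    (toPoly (shift δ b g)).degree < (toPoly f).degree := by
  have hf : toPoly f ≠ 0 := degree_ne_bot.1 hg.ne_bot
  rw [degree_eq_natDegree hf] at hg ⊢
  exact degree_shift_lt b hg

end Shift

end DiffPoly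

namespace RingDerivation

/-- A derivation of a commutative algebra, viewed as a derivation of its underlying ring. -/
def ofDerivation {R A : Type*} [CommRing R] [CommRing A] [Algebra R A] (d : Derivation R A A) :
    RingDerivation A where
  __ := d.toLinearMap.toAddMonoidHom
  leibniz' a b := (d.leibniz a b).trans (congrArg (a * d b + ·) (mul_comm b (d a)))

end RingDerivation

namespace DiffPoly

open Polynomial

section Action

open RingDerivation (ofDerivation)

theorem mul_t {D : Type*} [Ring D] {δ : RingDerivation D} (h : DiffPoly δ) :
    h * t δ = ofPoly δ (toPoly h * X) := by
  change ofPoly δ (toPoly h) * t δ = _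
  rw [ofPoly_eq_eval₂, ofPoly_eq_eval₂, eval₂_mul_X]

theorem lie_t {D : Type*} [Ring D] {δ : RingDerivation D} (h : DiffPoly δ) :
    ⁅t δ, h⁆ = ofPoly δ (coeffDer δ (toPoly h)) := by
  rw [Ring.lie_def, t_mul, mul_t, tMul_apply]
  exact add_sub_cancel_left (G := D[X]) _ _

theorem degree_coeffDer_lt {D : Type*} [Ring D] [Nontrivial D] (δ : RingDerivation D) {h : D[X]}
    (hh : h.Monic) : (coeffDer δ h).degree < h.degree := by
  rw [degree_eq_natDegree hh.ne_zero, degree_lt_iff_coeff_zero]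
  intro n hn
  rw [coeff_coeffDer]
  obtain rfl | hn := hn.eq_or_lt
  · rw [hh.coeff_natDegree, δ.map_one_eq_zero]
  · rw [coeff_eq_zero_of_natDegree_lt hn, map_zero]

section Ring

variable {F K : Type*} [CommRing F] [CommRing K] [Algebra F K] (d : Derivation F K K)

theorem lie_toLinearMap_lmul (a : K) :
    ⁅d.toLinearMap, Algebra.lmul F K a⁆ = Algebra.lmul F K (d a) := LinearMap.ext fun x => by
  change d (a * x) - a * d x = d a * x
  rw [d.leibniz, smul_eq_mul, smul_eq_mul, add_sub_cancel_left, mul_comm]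

/-- The `K[t;d]`-module structure of `K`, in which `t` acts as the derivation `d` and the
coefficients act by multiplication. -/
noncomputable def action : DiffPoly (ofDerivation d) →+* Module.End F K :=
  lift (Algebra.lmul F K) d.toLinearMap (lie_toLinearMap_lmul d)

theorem action_t : action d (t _) = d.toLinearMap := lift_t _

theorem action_smul (a : K) (h : DiffPoly (ofDerivation d)) :
    action d (a • h) = Algebra.lmul F K a * action d h := by
  rw [← constHom_mul, map_mul]
  exact congrArg (· * _) (lift_constHom _ a)

theorem action_ofPoly_map (q : F[X]) :
    action d (ofPoly _ (q.map (algebraMap F K))) = aeval d.toLinearMap q := by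
  refine (lift_ofPoly _ _).trans ?_
  rw [eval₂_map, aeval_def]
  exact congrArg (eval₂ · _ q) (Algebra.lmul F K).comp_algebraMap

theorem action_shift_ofPoly_map (b : K) (q : F[X]) :
    action d (shift _ b (ofPoly _ (q.map (algebraMap F K)))) =
      aeval (d.toLinearMap - Algebra.lmul F K b) q := by
  have hcoeff : ((action d).comp (shift _ b)).comp ((constHom _).comp (algebraMap F K)) =
      algebraMap F (Module.End F K) := RingHom.ext fun c => by
    simp only [RingHom.comp_apply, shift_constHom]
    exact (lift_constHom _ _).trans ((Algebra.lmul F K).commutes c)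
  have ht : (action d).comp (shift _ b) (t _) = d.toLinearMap - Algebra.lmul F K b := by
    rw [RingHom.comp_apply, shift_t, map_sub, action_t]
    exact congrArg (_ - ·) (lift_constHom _ b)
  rw [ofPoly_eq_eval₂, eval₂_map, ← RingHom.comp_apply, hom_eval₂, hcoeff, ht, aeval_def]

end Ring

variable {F K : Type*} [CommRing F] [Field K] [Algebra F K] {d : Derivation F K K}

theorem mem_lifts_of_coeffDer_eq_zero (hconst : ∀ c, d c = 0 → c ∈ (algebraMap F K).range)
    {h : K[X]} (hh : coeffDer (ofDerivation d) h = 0) : h ∈ lifts (algebraMap F K) := by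
  refine (lifts_iff_coeff_lifts h).2 fun n => hconst _ ?_
  rw [← coeff_zero n, ← hh, coeff_coeffDer]
  rfl

theorem degree_minpoly_le_of_action_eq_zero (hconst : ∀ c, d c = 0 → c ∈ (algebraMap F K).range)
    {h : DiffPoly (ofDerivation d)} (hne : toPoly h ≠ 0) (hh : action d h = 0) :
    (minpoly F d.toLinearMap).degree ≤ (toPoly h).degree := by
  induction hn : (toPoly h).degree using WellFoundedLT.induction generalizing h with
  | ind n ih =>
  set c := (toPoly h).leadingCoeff⁻¹
  have hsmul : toPoly (c • h) = toPoly h * Polynomial.C c :=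
    (smul_eq_C_mul c).trans (mul_comm _ (toPoly h))
  have hmonic : (toPoly (c • h)).Monic := hsmul ▸ monic_mul_leadingCoeff_inv hne
  have hdegree : (toPoly (c • h)).degree = (toPoly h).degree :=
    hsmul ▸ degree_mul_leadingCoeff_inv _ hne
  have haction : action d (c • h) = 0 := by rw [action_smul, hh, mul_zero]
  obtain hzero | hnonzero := eq_or_ne (coeffDer (ofDerivation d) (toPoly (c • h))) 0
  · obtain ⟨q, hq, hqdegree, hqmonic⟩ :=
      lifts_and_degree_eq_and_monic (mem_lifts_of_coeffDer_eq_zero hconst hzero) hmonic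
    rw [← hn, ← hdegree, ← hqdegree]
    refine minpoly.min F _ hqmonic ?_
    rw [← action_ofPoly_map, hq]
    exact haction
  · have hlt := degree_coeffDer_lt (ofDerivation d) hmonic
    have hlie : action d (ofPoly _ (coeffDer (ofDerivation d) (toPoly (c • h)))) = 0 := by
      rw [← lie_t, Ring.lie_def, map_sub, map_mul, map_mul, haction, mul_zero, zero_mul, sub_zero]
    rw [hdegree, hn] at hlt
    exact (ih _ hlt hnonzero hlie rfl).trans hlt.le

end Action

section Eigenvector

open Module.End RingDerivation

variable {F K : Type*} [Field F] [Field K] [Algebra F K] {d : Derivation F K K}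

theorem eval_zero_minpoly_toLinearMap (d : Derivation F K K) :
    (minpoly F d.toLinearMap).eval 0 = 0 := by
  have hone : HasEigenvector d.toLinearMap (0 : F) 1 :=
    ⟨mem_eigenspace_iff.2 (by rw [zero_smul]; exact d.map_one_eq_zero), one_ne_zero⟩
  have h := aeval_apply_of_hasEigenvector (p := minpoly F d.toLinearMap) hone
  rw [minpoly.aeval, LinearMap.zero_apply] at h
  exact (smul_eq_zero.1 h.symm).resolve_right one_ne_zero

theorem aeval_minpoly_sub_lmul_apply_eq_zero {b c : K} (hc : d c = b * c) :
    aeval (d.toLinearMap - Algebra.lmul F K b) (minpoly F d.toLinearMap) c = 0 := by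
  obtain rfl | hne := eq_or_ne c 0
  · exact map_zero _
  have hker : HasEigenvector (d.toLinearMap - Algebra.lmul F K b) (0 : F) c :=
    ⟨mem_eigenspace_iff.2 ((sub_eq_zero.2 hc).trans (zero_smul F c).symm), hne⟩
  rw [aeval_apply_of_hasEigenvector hker, eval_zero_minpoly_toLinearMap, zero_smul]

theorem exists_eq_mul_of_aeval_minpoly_sub_lmul_eq_zero
    (hconst : ∀ c, d c = 0 → c ∈ (algebraMap F K).range) (hd : IsIntegral F d.toLinearMap) {b : K}
    (hb : aeval (d.toLinearMap - Algebra.lmul F K b) (minpoly F d.toLinearMap) = 0) :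
    ∃ c ≠ 0, d c = b * c := by
  by_contra! hne
  have hinj : Function.Injective (d.toLinearMap - Algebra.lmul F K b) :=
    (injective_iff_map_eq_zero _).2 fun c hc => by_contra fun h0 => hne c h0 (sub_eq_zero.1 hc)
  obtain ⟨q, hq⟩ : X ∣ minpoly F d.toLinearMap :=
    X_dvd_iff.2 ((coeff_zero_eq_eval_zero _).trans (eval_zero_minpoly_toLinearMap d))
  have hq0 : q ≠ 0 := right_ne_zero_of_mul (hq ▸ minpoly.ne_zero hd)
  have hqb : aeval (d.toLinearMap - Algebra.lmul F K b) q = 0 := by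
    rw [hq, map_mul, aeval_X] at hb
    exact LinearMap.ext fun x => hinj ((LinearMap.congr_fun hb x).trans (map_zero _).symm)
  have hdegree : (toPoly (ofPoly (ofDerivation d) (q.map (algebraMap F K)))).degree <
      (minpoly F d.toLinearMap).natDegree := by
    rw [← degree_eq_natDegree (minpoly.ne_zero hd), hq, mul_comm]
    exact (degree_map q _).trans_lt (degree_lt_degree_mul_X hq0)
  refine (degree_shift_lt b hdegree).not_ge ?_
  rw [← degree_eq_natDegree (minpoly.ne_zero hd)]
  refine degree_minpoly_le_of_action_eq_zero hconst (fun hzero => hq0 ?_)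
    ((action_shift_ofPoly_map d b q).trans hqb)
  have hshift : shift (ofDerivation d) b (ofPoly _ (q.map (algebraMap F K))) = shift _ b 0 :=
    hzero.trans (map_zero _).symm
  exact (Polynomial.map_eq_zero _).1 (shift_injective b hshift)

end Eigenvector

end DiffPoly

namespace RingDerivation

open Polynomial

section LogarithmicDerivative

variable {C D : Type*} [Field C] [DivisionRing D] [Algebra C D] [Algebra.IsCentral C D]
  {δ : RingDerivation D}

variable (C δ) in
/-- `δ|_C` as a derivation over its field of constants `F`. -/
noncomputable def constDer : Derivation (δ.constField C) C C :=
  Derivation.mk' (δ.centerEnd C) (δ.centerDer C).leibniz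

variable (p : ℕ) [Fact p.Prime] [CharP C p] (e : ℕ) (a : ℕ → δ.constField C)

theorem aeval_pPolynomial_centerEnd_sub_lmul
    (hg : aeval (δ.centerEnd C) (pPolynomial p e a) = 0) (b : C) :
    aeval (δ.centerEnd C - Algebra.lmul (δ.constField C) C b) (pPolynomial p e a) =
      -Algebra.lmul (δ.constField C) C (δ.V C p e a b) := by
  let φ : C →+* Module.End (δ.constField C) C := Algebra.lmul (δ.constField C) C
  have hφ : φ.comp (δ.constField C).subtype = algebraMap _ _ :=
    (Algebra.lmul (δ.constField C) C).comp_algebraMap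
  have h := eval₂_pPolynomial_sub_map p e a (φ := φ) (x := δ.centerEnd C)
    (DiffPoly.lie_toLinearMap_lmul (constDer C δ)) b
  rwa [hφ, ← aeval_def, ← aeval_def, hg, zero_sub] at h

theorem V_eq_zero_iff (hg : minpoly (δ.constField C) (δ.centerEnd C) = pPolynomial p e a) (b : C) :
    δ.V C p e a b = 0 ↔ ∃ c : C, c ≠ 0 ∧ b = δ.centerDer C c / c := by
  have haeval := aeval_pPolynomial_centerEnd_sub_lmul p e a (hg ▸ minpoly.aeval _ _) b
  rw [← hg] at haeval
  constructor
  · intro hb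
    rw [hb, map_zero, neg_zero] at haeval
    have hintegral : IsIntegral (δ.constField C) (δ.centerEnd C) := by
      rw [← minpoly.ne_zero_iff, hg, ← degree_ne_bot,
        degree_pPolynomial (Fact.out : p.Prime).one_lt]
      exact WithBot.coe_ne_bot
    obtain ⟨c, hc, hbc⟩ := DiffPoly.exists_eq_mul_of_aeval_minpoly_sub_lmul_eq_zero
      (d := constDer C δ) (fun c hc => ⟨⟨c, hc⟩, rfl⟩) hintegral haeval
    exact ⟨c, hc, (eq_div_iff hc).2 hbc.symm⟩
  · rintro ⟨c, hc, hbc⟩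
    have h : -(δ.V C p e a b * c) = 0 := (LinearMap.congr_fun haeval c).symm.trans
      (DiffPoly.aeval_minpoly_sub_lmul_apply_eq_zero (d := constDer C δ)
        ((eq_div_iff hc).1 hbc).symm)
    exact (mul_eq_zero.1 (neg_eq_zero.1 h)).resolve_right hc

end LogarithmicDerivative

end RingDerivation

namespace DiffPoly

open Polynomial

section ShiftDivision

variable {C D : Type*} [CommRing C] [DivisionRing D] [Algebra C D] {δ : RingDerivation D}

theorem shift_mem_petitSubmodule (b : C) {f g : DiffPoly δ} (hg : g ∈ petitSubmodule f) :
    shift δ b g ∈ petitSubmodule f :=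
  hg.imp (degree_shift_lt_degree b) fun h => (congrArg _ h).trans (map_zero _)

theorem shift_modRight {b : C} {f : DiffPoly δ} (hf : shift δ b f = f) (g : DiffPoly δ) :
    shift δ b (modRight g f) = modRight (shift δ b g) f := by
  obtain rfl | h0 := eq_or_ne f 0
  · simp [modRight]
  · obtain ⟨⟨q, hq⟩, hdegree⟩ := modRight_spec g f h0
    refine (modRight_eq (q := shift δ b q) ?_ (degree_shift_lt_degree b hdegree)).symm
    conv_lhs => rw [hq, map_add, map_mul, hf]

end ShiftDivision

section ShiftPPolynomial

instance {D : Type*} [Ring D] [Nontrivial D] {δ : RingDerivation D} : Nontrivial (DiffPoly δ) :=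
  inferInstanceAs (Nontrivial D[X])

variable {C D : Type*} [Field C] [DivisionRing D] [Algebra C D] [Algebra.IsCentral C D]
  {δ : RingDerivation D}

theorem lie_t_centerHom (c : C) : ⁅t δ, centerHom δ c⁆ = centerHom δ (δ.centerDer C c) := by
  rw [centerHom, RingHom.comp_apply, lie_t_constHom, ← δ.algebraMap_centerDer C]
  rfl

theorem degree_ofPoly_map_pPolynomial_sub_const {p : ℕ} (hp : 1 < p) (e : ℕ)
    (a : ℕ → δ.constField C) (d : D) :
    (toPoly (ofPoly δ ((RingDerivation.pPolynomial p e a).map (δ.constEmb C)) -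
      const δ d)).degree = (p ^ e : ℕ) := by
  have hdegree : ((RingDerivation.pPolynomial p e a).map (δ.constEmb C)).degree = (p ^ e : ℕ) := by
    rw [degree_map, RingDerivation.degree_pPolynomial hp]
  have hpos : 0 < ((RingDerivation.pPolynomial p e a).map (δ.constEmb C)).degree := by
    rw [hdegree]
    exact_mod_cast pow_pos (zero_lt_one.trans hp) e
  exact (degree_sub_C hpos).trans hdegree

variable (p : ℕ) [Fact p.Prime] [CharP C p]

theorem t_sub_centerHom_pow_char_pow (j : ℕ) (b : C) :
    (t δ - centerHom δ b) ^ p ^ j = t δ ^ p ^ j - centerHom δ (δ.Vpow C p j b) :=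
  RingDerivation.sub_map_pow_char_pow p lie_t_centerHom j b

variable (e : ℕ) (a : ℕ → δ.constField C)

theorem shift_ofPoly_map_pPolynomial (b : C) :
    shift δ b (ofPoly δ ((RingDerivation.pPolynomial p e a).map (δ.constEmb C))) =
      ofPoly δ ((RingDerivation.pPolynomial p e a).map (δ.constEmb C)) -
        centerHom δ (δ.V C p e a b) := by
  have hcoeff : (shift δ b).comp ((constHom δ).comp (δ.constEmb C)) =
      (centerHom δ).comp (δ.constField C).subtype := RingHom.ext fun _ => shift_constHom b _
  rw [ofPoly_eq_eval₂, eval₂_map, hom_eval₂, hcoeff, shift_t,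
    RingDerivation.eval₂_pPolynomial_sub_map p e a lie_t_centerHom]
  rfl

theorem shift_eq_self {b : C} (hb : δ.V C p e a b = 0) (d : D) :
    shift δ b (ofPoly δ ((RingDerivation.pPolynomial p e a).map (δ.constEmb C)) - const δ d) =
      ofPoly δ ((RingDerivation.pPolynomial p e a).map (δ.constEmb C)) - const δ d := by
  rw [map_sub, shift_ofPoly_map_pPolynomial, hb, map_zero, sub_zero]
  exact congrArg (_ - ·) (shift_constHom b d)

end ShiftPPolynomial

end DiffPoly

namespace PetitAlgebra

section Shift

variable {C D : Type*} [Field C] [DivisionRing D] [Algebra C D] {δ : RingDerivation D}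
  {f : DiffPoly δ}

/-- The restriction of `G_{id,-b}` to `S_f`. -/
noncomputable def shift (b : C) (x : PetitAlgebra f) : PetitAlgebra f :=
  (⟨DiffPoly.shift δ b x.val, DiffPoly.shift_mem_petitSubmodule b x.2⟩ : petitSubmodule f)

theorem val_shift (b : C) (x : PetitAlgebra f) : (shift b x).val = DiffPoly.shift δ b x.val := rfl

theorem shift_shift (b c : C) (x : PetitAlgebra f) : shift b (shift c x) = shift (b + c) x :=
  val_injective (DiffPoly.shift_shift b c _)

theorem shift_zero (x : PetitAlgebra f) : shift (0 : C) x = x :=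
  val_injective (DiffPoly.shift_zero _)

theorem shift_mul {b : C} (hf : DiffPoly.shift δ b f = f) (x y : PetitAlgebra f) :
    shift b (x * y) = shift b x * shift b y :=
  val_injective (by simp only [val_shift, val_mul, DiffPoly.shift_modRight hf, map_mul])

variable [Algebra.IsCentral C D]

variable (f) in
/-- `G_{id,-b}` as an automorphism of the `F`-vector space `S_f`. -/
noncomputable def shiftEquiv (b : C) : PetitAlgebra f ≃ₗ[δ.constField C] PetitAlgebra f where
  toFun := shift b
  invFun := shift (-b)
  left_inv x := by rw [shift_shift, neg_add_cancel, shift_zero]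
  right_inv x := by rw [shift_shift, add_neg_cancel, shift_zero]
  map_add' _ _ := val_injective (map_add (DiffPoly.shift δ b) _ _)
  map_smul' c _ := val_injective (DiffPoly.shift_smul b (δ.constEmb C c) _)

/-- `b ↦ G_{id,-b}` as a homomorphism to `Aut_F(S_f)`, on a group of shifts that fix `f`. -/
noncomputable def shiftAut (K : AddSubgroup C) (hK : ∀ b ∈ K, DiffPoly.shift δ b f = f) :
    Multiplicative K →* autF C f where
  toFun b := ⟨shiftEquiv f b.toAdd, shift_mul (hK _ b.toAdd.2)⟩
  map_one' := Subtype.ext (LinearEquiv.ext shift_zero)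
  map_mul' _ _ := Subtype.ext (LinearEquiv.ext fun x => (shift_shift _ _ x).symm)

theorem val_shiftAut {K : AddSubgroup C} (hK : ∀ b ∈ K, DiffPoly.shift δ b f = f)
    (b : Multiplicative K) (x : PetitAlgebra f) : ((shiftAut K hK b).1 x).val =
      DiffPoly.G δ (RingEquiv.refl D) (-algebraMap C D b.toAdd) x.val :=
  DiffPoly.shift_eq_G _ _

theorem mem_range_shiftAut {K : AddSubgroup C} (hK : ∀ b ∈ K, DiffPoly.shift δ b f = f)
    (φ : autF C f) : φ ∈ (shiftAut K hK).range ↔ ∃ b ∈ K, ∀ x,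
      (φ.1 x).val = DiffPoly.G δ (RingEquiv.refl D) (-algebraMap C D b) x.val := by
  constructor
  · rintro ⟨b, rfl⟩
    exact ⟨b.toAdd, b.toAdd.2, val_shiftAut hK b⟩
  · rintro ⟨b, hb, h⟩
    exact ⟨.ofAdd ⟨b, hb⟩, Subtype.ext (LinearEquiv.ext fun x =>
      val_injective ((val_shiftAut hK _ x).trans (h x).symm))⟩

theorem shiftAut_injective {K : AddSubgroup C} (hK : ∀ b ∈ K, DiffPoly.shift δ b f = f)
    (hf : 1 < (DiffPoly.toPoly f).degree) : Function.Injective (shiftAut K hK) := by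
  refine (injective_iff_map_eq_one _).2 fun b hb => ?_
  let x : PetitAlgebra f := (⟨DiffPoly.t δ, Or.inl (Polynomial.degree_X_le.trans_lt hf)⟩ :
    petitSubmodule f)
  have ht : DiffPoly.shift δ (b.toAdd : C) (DiffPoly.t δ) = DiffPoly.t δ :=
    congrArg (fun φ : autF C f => (φ.1 x).val) hb
  rw [DiffPoly.shift_t, sub_eq_self] at ht
  have hconst : algebraMap C D b.toAdd = 0 :=
    DiffPoly.constHom_injective (ht.trans (map_zero _).symm)
  exact Subtype.ext ((map_eq_zero _).1 hconst)

end Shift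

end PetitAlgebra

theorem mainTheorem9_general {C D : Type*} [Field C] [DivisionRing D] [Algebra C D]
    [Algebra.IsCentral C D] (p : ℕ) [Fact p.Prime] [CharP C p]
    (δ : RingDerivation D) (e : ℕ) (a : ℕ → δ.constField C)
    (hg : minpoly (δ.constField C) (δ.centerEnd C) =
      Polynomial.X ^ p ^ e +
        ∑ i ∈ Finset.Icc 1 e, Polynomial.C (a i) * Polynomial.X ^ p ^ (e - i))
    (d : D) (f : DiffPoly δ)
    (hf : f = DiffPoly.ofPoly δ
        ((minpoly (δ.constField C) (δ.centerEnd C)).map (δ.constEmb C)) - DiffPoly.const δ d) :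
    (∀ (j : ℕ) (b : C),
      (DiffPoly.t δ - DiffPoly.const δ (algebraMap C D b)) ^ p ^ j =
        DiffPoly.t δ ^ p ^ j - DiffPoly.const δ (algebraMap C D (δ.Vpow C p j b))) ∧
    (∀ b : C, δ.V C p e a b ∈ δ.constField C) ∧
    {b : C | δ.V C p e a b = 0} = {b : C | ∃ c : C, c ≠ 0 ∧ b = δ.centerDer C c / c} ∧
    ∃ H : Subgroup (PetitAlgebra.autF C f),
      (∀ φ : PetitAlgebra.autF C f, φ ∈ H ↔ ∃ b : C, δ.V C p e a b = 0 ∧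
        ∀ x : PetitAlgebra f,
          (φ.1 x).val = DiffPoly.G δ (RingEquiv.refl D) (-algebraMap C D b) x.val) ∧
      ∃ Φ : Multiplicative (δ.V C p e a).ker ≃* H,
        ∀ (b : (δ.V C p e a).ker) (x : PetitAlgebra f),
          ((Φ (Multiplicative.ofAdd b)).1.1 x).val =
            DiffPoly.G δ (RingEquiv.refl D) (-algebraMap C D b.1) x.val := by
  have hgp : minpoly _ (δ.centerEnd C) = RingDerivation.pPolynomial p e a := hg
  have hfix : ∀ b ∈ (δ.V C p e a).ker, DiffPoly.shift δ b f = f := fun b hb => by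
    rw [hf, hgp]
    exact DiffPoly.shift_eq_self p e a hb d
  have hinj : Function.Injective (PetitAlgebra.shiftAut _ hfix) := by
    obtain rfl | he := eq_or_ne e 0
    · exact (injective_iff_map_eq_one _).2 fun b _ =>
        Subtype.ext ((RingDerivation.V_exponent_zero p a _).symm.trans b.toAdd.2)
    · refine PetitAlgebra.shiftAut_injective hfix ?_
      have hp : 1 < p := (Fact.out : p.Prime).one_lt
      rw [hf, hgp]
      exact (Nat.cast_lt.2 (Nat.one_lt_pow he hp)).trans_eq
        (DiffPoly.degree_ofPoly_map_pPolynomial_sub_const hp e a d).symm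
  exact ⟨fun j b => DiffPoly.t_sub_centerHom_pow_char_pow p j b,
    RingDerivation.V_mem_constField p e a (hgp ▸ minpoly.aeval _ _),
    Set.ext (RingDerivation.V_eq_zero_iff p e a hgp),
    (PetitAlgebra.shiftAut _ hfix).range, PetitAlgebra.mem_range_shiftAut hfix,
    MonoidHom.ofInjective hinj, fun b => PetitAlgebra.val_shiftAut hfix (.ofAdd b)⟩

theorem mainTheorem9 {C D : Type*} [Field C] [DivisionRing D] [Algebra C D]
    [Algebra.IsCentral C D] [FiniteDimensional C D] (p : ℕ) [Fact p.Prime] [CharP C p]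
    (δ : RingDerivation D) (e : ℕ) (a : ℕ → δ.constField C)
    (hg : minpoly (δ.constField C) (δ.centerEnd C) =
      Polynomial.X ^ p ^ e +
        ∑ i ∈ Finset.Icc 1 e, Polynomial.C (a i) * Polynomial.X ^ p ^ (e - i))
    (d : D) (f : DiffPoly δ)
    (hf : f = DiffPoly.ofPoly δ
        ((minpoly (δ.constField C) (δ.centerEnd C)).map (δ.constEmb C)) - DiffPoly.const δ d) :
    (∀ (j : ℕ) (b : C),
      (DiffPoly.t δ - DiffPoly.const δ (algebraMap C D b)) ^ p ^ j =
        DiffPoly.t δ ^ p ^ j - DiffPoly.const δ (algebraMap C D (δ.Vpow C p j b))) ∧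
    (∀ b : C, δ.V C p e a b ∈ δ.constField C) ∧
    {b : C | δ.V C p e a b = 0} = {b : C | ∃ c : C, c ≠ 0 ∧ b = δ.centerDer C c / c} ∧
    ∃ H : Subgroup (PetitAlgebra.autF C f),
      (∀ φ : PetitAlgebra.autF C f, φ ∈ H ↔ ∃ b : C, δ.V C p e a b = 0 ∧
        ∀ x : PetitAlgebra f,
          (φ.1 x).val = DiffPoly.G δ (RingEquiv.refl D) (-algebraMap C D b) x.val) ∧
      ∃ Φ : Multiplicative (δ.V C p e a).ker ≃* H,
        ∀ (b : (δ.V C p e a).ker) (x : PetitAlgebra f),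
          ((Φ (Multiplicative.ofAdd b)).1.1 x).val =
            DiffPoly.G δ (RingEquiv.refl D) (-algebraMap C D b.1) x.val :=
  mainTheorem9_general p δ e a hg d f hf
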